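/- Let $\mathbb K$ be $\mathbb R$ or $\mathbb C$. For Banach spaces $X_1,\dots,X_n$ over $\mathbb K$ ($n\ge 1$) let $\Sigma_{X_1\dots X_n}=\{x^1\otimes\cdots\otimes x^n : x^i\in X_i\}\subset X_1\otimes\cdots\otimes X_n$. A reasonable crossnorm on $X_1\otimes\cdots\otimes X_n$ is a norm $\beta$ with $\varepsilon\le\beta\le\pi$, where $\varepsilon,\pi$ are the injective and projective tensor norms; for subspaces $E_i\subset X_i$ its restriction to $E_1\otimes\cdots\otimes E_n$ is denoted $\beta|$. For a bounded multilinear operator $T:X_1\times\cdots\times X_n\to Y$ let $\tilde T$ be its linearization and $f_T=\tilde T|_{\Sigma_{X_1\dots X_n}}$. Let $\mathcal L^\beta(X_1,\dots,X_n)$ be the space of multilinear forms $\varphi$ whose linearization is bounded on $(X_1\otimes\cdots\otimes X_n,\beta)$, with $\|\varphi\|_\beta=\|\tilde\varphi\|$. A $\Sigma$-ideal $[\mathcal A,A]$ assigns to all $n\ge1$, all Banach spaces $X_1,\dots,X_n,Y$ over $\mathbb K$ and every reasonable crossnorm $\beta$ on $X_1\otimes\cdots\otimes X_n$ a linear subspace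 $\mathcal A^\beta(X_1,\dots,X_n;Y)$ of the space $\mathcal L(X_1,\dots,X_n;Y)$ of bounded multilinear operators, with a complete norm $A^\beta$ on it, such that: 1. $\varphi\cdot y\in\mathcal A^\beta(X_1,\dots,X_n;Y)$ and $A^\beta(\varphi\cdot y)\le\|\varphi\|_\beta\|y\|$ for all $\varphi\in\mathcal L^\beta(X_1,\dots,X_n)$ and $y\in Y$; 2. $\|f_T(p)-f_T(q)\|\le A^\beta(T)\,\beta(p-q)$ for all $T\in\mathcal A^\beta(X_1,\dots,X_n;Y)$ and $p,q\in\Sigma_{X_1\dots X_n}$; 3. if $T\in\mathcal A^\beta(X_1,\dots,X_n;Y)$, $S:Y\to W$ is a bounded linear operator between Banach spaces, $\theta$ is a reasonable crossnorm on $Z_1\otimes\cdots\otimes Z_m$ ($Z_j$ Banach spaces, $m\ge1$), and $R:Z_1\times\cdots\times Z_m\to X_1\otimes\cdots\otimes X_n$ is a multilinear map whose linearization $\tilde R:(Z_1\otimes\cdots\otimes Z_m,\theta)\to(X_1\otimes\cdots\otimes X_n,\beta)$ is bounded and maps $\Sigma_{Z_1\dots Z_m}$ into $\Sigma_{X_1\dots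 X_n}$, then $Sf_TR\in\mathcal A^\theta(Z_1,\dots,Z_m;W)$ and $A^\theta(Sf_TR)\le\|\tilde R\|\,A^\beta(T)\,\|S\|$. For $T\in\mathcal L(X_1,\dots,X_n;Y)$ put $$A^{\max,\beta}(T)=\sup A^{\beta|}\bigl(Q_L\circ T|_{E_1\times\cdots\times E_n}:E_1\times\cdots\times E_n\to Y/L\bigr)\in[0,\infty],$$ the supremum being over all finite dimensional subspaces $E_i\subset X_i$ and all closed finite codimensional subspaces $L\subset Y$, where $Q_L:Y\to Y/L$ is the quotient map. The $\Sigma$-ideal $[\mathcal A,A]$ is maximal if it coincides with its maximal hull, i.e. if for all $n$, $X_i$, $Y$, $\beta$ and all $T\in\mathcal L(X_1,\dots,X_n;Y)$ one has $T\in\mathcal A^\beta(X_1,\dots,X_n;Y)$ if and only if $A^{\max,\beta}(T)<\infty$, and in that case $A^\beta(T)=A^{\max,\beta}(T)$. **Proposition.** Let $[\mathcal A,A]$ be a maximal $\Sigma$-ideal, $n\ge 1$, $X_1,\dots,X_n,Y$ Banach spaces, $\beta$ a reasonable crossnorm on $X_1\otimes\cdots\otimes X_n$, and $T\in\mathcal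 L(X_1,\dots,X_n;Y)$. Let $K_Y:Y\to Y^{**}$ be the canonical embedding. Then $T\in\mathcal A^\beta(X_1,\dots,X_n;Y)$ if and only if $K_YT\in\mathcal A^\beta(X_1,\dots,X_n;Y^{**})$, and in that case $A^\beta(T)=A^\beta(K_YT)$. -/

import Mathlib

open scoped TensorProduct ENNReal

universe u

namespace SigmaIdeals

/-! ## Tensor products of Banach spaces, the Segre cone, and reasonable crossnorms -/

section Tensor

variable {𝕜 : Type} [RCLike 𝕜] {n : ℕ}
  {X : Fin n → Type u} [∀ i, NormedAddCommGroup (X i)] [∀ i, NormedSpace 𝕜 (X i)]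

/-- The `n`-linear form `(x¹, …, xⁿ) ↦ x₁*(x¹) ⋯ xₙ*(xⁿ)`. -/
noncomputable def dualForm (f : ∀ i, StrongDual 𝕜 (X i)) : ContinuousMultilinearMap 𝕜 X 𝕜 :=
  (ContinuousMultilinearMap.mkPiAlgebra 𝕜 (Fin n) 𝕜).compContinuousLinearMap f

@[simp]
theorem dualForm_apply (f : ∀ i, StrongDual 𝕜 (X i)) (x : ∀ i, X i) :
    dualForm f x = ∏ i, f i (x i) := by
  simp [dualForm]

/-- The linearization `X₁ ⊗ ⋯ ⊗ Xₙ → Y` of a multilinear operator `T : X₁ × ⋯ × Xₙ → Y`. -/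
noncomputable def linearization {Y : Type*} [NormedAddCommGroup Y] [NormedSpace 𝕜 Y]
    (T : ContinuousMultilinearMap 𝕜 X Y) : (⨂[𝕜] i, X i) →ₗ[𝕜] Y :=
  PiTensorProduct.lift T.toMultilinearMap

@[simp]
theorem linearization_tprod {Y : Type*} [NormedAddCommGroup Y] [NormedSpace 𝕜 Y]
    (T : ContinuousMultilinearMap 𝕜 X Y) (x : ∀ i, X i) :
    linearization T (PiTensorProduct.tprod 𝕜 x) = T x := by
  simp [linearization]

variable (𝕜 X) in
/-- The set `Σ_{X₁ … Xₙ}` of decomposable tensors `x¹ ⊗ ⋯ ⊗ xⁿ`. -/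
def segreCone : Set (⨂[𝕜] i, X i) :=
  Set.range fun x : ∀ i, X i => PiTensorProduct.tprod 𝕜 x

/-- The `Σ`-operator `f_T : Σ_{X₁ … Xₙ} → Y` associated with `T`: the restriction of the
linearization of `T` to the decomposable tensors. -/
noncomputable def sigmaOp {Y : Type*} [NormedAddCommGroup Y] [NormedSpace 𝕜 Y]
    (T : ContinuousMultilinearMap 𝕜 X Y) : segreCone 𝕜 X → Y :=
  fun p => linearization T p

/-- The injective tensor norm
`ε(u) = sup {|(x₁* ⊗ ⋯ ⊗ xₙ*)(u)| : ‖xᵢ*‖ ≤ 1}`. -/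
noncomputable def injectiveNorm (u : ⨂[𝕜] i, X i) : ℝ :=
  ⨆ f : {f : ∀ i, StrongDual 𝕜 (X i) // ∀ i, ‖f i‖ ≤ 1}, ‖linearization (dualForm f.1) u‖

theorem norm_dualForm_le_one (f : ∀ i, StrongDual 𝕜 (X i)) (hf : ∀ i, ‖f i‖ ≤ 1) :
    ‖dualForm f‖ ≤ 1 := by
  refine ContinuousMultilinearMap.opNorm_le_bound zero_le_one fun x => ?_
  rw [dualForm_apply, norm_prod, one_mul]
  exact Finset.prod_le_prod (fun _ _ => norm_nonneg _) fun i _ =>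
    ((f i).le_opNorm (x i)).trans (mul_le_of_le_one_left (norm_nonneg _) (hf i))

theorem bddAbove_injectiveNorm (u : ⨂[𝕜] i, X i) :
    BddAbove (Set.range fun f : {f : ∀ i, StrongDual 𝕜 (X i) // ∀ i, ‖f i‖ ≤ 1} =>
      ‖linearization (dualForm f.1) u‖) := by
  refine ⟨‖u‖, ?_⟩
  rintro _ ⟨f, rfl⟩
  exact (PiTensorProduct.norm_eval_le_projectiveSeminorm (dualForm f.1) u).trans
    (mul_le_of_le_one_left (norm_nonneg _) (norm_dualForm_le_one f.1 f.2))

theorem le_injectiveNorm (f : ∀ i, StrongDual 𝕜 (X i)) (hf : ∀ i, ‖f i‖ ≤ 1)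
    (u : ⨂[𝕜] i, X i) : ‖linearization (dualForm f) u‖ ≤ injectiveNorm u :=
  le_ciSup (bddAbove_injectiveNorm u) ⟨f, hf⟩

theorem prod_norm_le_injectiveNorm (x : ∀ i, X i) :
    ∏ i, ‖x i‖ ≤ injectiveNorm (PiTensorProduct.tprod 𝕜 x) := by
  choose f hf hfx using fun i => exists_dual_vector'' 𝕜 (x i)
  have h := le_injectiveNorm f hf (PiTensorProduct.tprod 𝕜 x)
  simpa [hfx, norm_prod] using h

variable (𝕜 X) in
/-- A reasonable crossnorm on `X₁ ⊗ ⋯ ⊗ Xₙ`: a norm `β` with `ε ≤ β ≤ π`. -/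
structure ReasonableCrossnorm where
  /-- the norm, as a real function on the algebraic tensor product -/
  toSeminorm : Seminorm 𝕜 (⨂[𝕜] i, X i)
  eq_zero_of_apply_eq_zero : ∀ u, toSeminorm u = 0 → u = 0
  injective_le : ∀ u, injectiveNorm u ≤ toSeminorm u
  le_projective : ∀ u, toSeminorm u ≤ PiTensorProduct.projectiveSeminorm u

instance : CoeFun (ReasonableCrossnorm 𝕜 X) fun _ => (⨂[𝕜] i, X i) → ℝ :=
  ⟨fun β => β.toSeminorm⟩

/-- The inclusion `E₁ ⊗ ⋯ ⊗ Eₙ → X₁ ⊗ ⋯ ⊗ Xₙ` for subspaces `Eᵢ` of `Xᵢ`. -/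
noncomputable def tensorIncl (E : ∀ i, Submodule 𝕜 (X i)) :
    (⨂[𝕜] i, E i) →ₗ[𝕜] (⨂[𝕜] i, X i) :=
  PiTensorProduct.map fun i => (E i).subtype

theorem tensorIncl_injective (E : ∀ i, Submodule 𝕜 (X i)) :
    Function.Injective (tensorIncl E) := by
  choose g hg using fun i =>
    (E i).subtype.exists_leftInverse_of_injective (Submodule.ker_subtype _)
  have h : (PiTensorProduct.map g).comp (tensorIncl E) = LinearMap.id := by
    rw [tensorIncl, ← PiTensorProduct.map_comp]
    simp [hg]
  exact Function.LeftInverse.injective (g := PiTensorProduct.map g)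
    fun u => LinearMap.congr_fun h u

theorem injectiveNorm_le_tensorIncl (E : ∀ i, Submodule 𝕜 (X i)) (u : ⨂[𝕜] i, E i) :
    injectiveNorm u ≤ injectiveNorm (tensorIncl E u) := by
  have : Nonempty {f : ∀ i, StrongDual 𝕜 (E i) // ∀ i, ‖f i‖ ≤ 1} := ⟨⟨0, by simp⟩⟩
  refine ciSup_le fun f => ?_
  choose g hg hgn using fun i => exists_extension_norm_eq (E i) (f.1 i)
  have h : linearization (dualForm f.1) = (linearization (dualForm g)).comp (tensorIncl E) := by
    ext x
    simp [tensorIncl, hg]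
  rw [h]
  exact le_injectiveNorm g (fun i => (hgn i).trans_le (f.2 i)) _

theorem tensorIncl_le_projective (E : ∀ i, Submodule 𝕜 (X i)) (u : ⨂[𝕜] i, E i) :
    PiTensorProduct.projectiveSeminorm (tensorIncl E u)
      ≤ PiTensorProduct.projectiveSeminorm u := by
  have h := (PiTensorProduct.mapL fun i => (E i).subtypeL).le_opNorm u
  have h1 : ‖PiTensorProduct.mapL fun i => (E i).subtypeL‖ ≤ 1 :=
    (PiTensorProduct.opNorm_mapL _).trans
      (Finset.prod_le_one (fun _ _ => norm_nonneg _) fun i _ => (E i).norm_subtypeL_le)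
  have h2 := h.trans (mul_le_of_le_one_left (norm_nonneg u) h1)
  rwa [PiTensorProduct.mapL_apply] at h2

/-- The restriction `β|` of a reasonable crossnorm to `E₁ ⊗ ⋯ ⊗ Eₙ`. -/
noncomputable def ReasonableCrossnorm.restrict (β : ReasonableCrossnorm 𝕜 X)
    (E : ∀ i, Submodule 𝕜 (X i)) : ReasonableCrossnorm 𝕜 (fun i => E i) where
  toSeminorm := β.toSeminorm.comp (tensorIncl E)
  eq_zero_of_apply_eq_zero u hu :=
    tensorIncl_injective E (by rw [β.eq_zero_of_apply_eq_zero _ hu, map_zero])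
  injective_le u := (injectiveNorm_le_tensorIncl E u).trans (β.injective_le _)
  le_projective u := (β.le_projective _).trans (tensorIncl_le_projective E u)

end Tensor

/-! ## Linear maps that are bounded with respect to given seminorms -/

section Bounded

variable {𝕜 : Type} [RCLike 𝕜] {V W : Type*} [AddCommGroup V] [Module 𝕜 V]
  [AddCommGroup W] [Module 𝕜 W]

/-- `f : (V, p) → (W, q)` is bounded. -/
def IsBoundedWrt (p : Seminorm 𝕜 V) (q : Seminorm 𝕜 W) (f : V →ₗ[𝕜] W) : Prop :=
  ∃ C : ℝ, 0 ≤ C ∧ ∀ v, q (f v) ≤ C * p v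

/-- The operator norm of `f : (V, p) → (W, q)`; meaningful if `f` is bounded. -/
noncomputable def opNormWrt (p : Seminorm 𝕜 V) (q : Seminorm 𝕜 W) (f : V →ₗ[𝕜] W) : ℝ :=
  sInf {C : ℝ | 0 ≤ C ∧ ∀ v, q (f v) ≤ C * p v}

end Bounded

/-! ## The space of `β`-bounded forms, and `Σ`-`β`-`θ`-operators -/

section Operators

variable {𝕜 : Type} [RCLike 𝕜] {n m : ℕ}
  {X : Fin n → Type u} [∀ i, NormedAddCommGroup (X i)] [∀ i, NormedSpace 𝕜 (X i)]
  {Z : Fin m → Type u} [∀ i, NormedAddCommGroup (Z i)] [∀ i, NormedSpace 𝕜 (Z i)]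
  {Y : Type u} [NormedAddCommGroup Y] [NormedSpace 𝕜 Y]
  {W : Type u} [NormedAddCommGroup W] [NormedSpace 𝕜 W]

/-- `φ ∈ 𝓛^β(X₁, …, Xₙ)`: the linearization of the multilinear form `φ` is bounded on
`(X₁ ⊗ ⋯ ⊗ Xₙ, β)`. -/
def IsBetaBounded (β : ReasonableCrossnorm 𝕜 X) (φ : ContinuousMultilinearMap 𝕜 X 𝕜) : Prop :=
  IsBoundedWrt β.toSeminorm (normSeminorm 𝕜 𝕜) (linearization φ)

/-- The norm `‖φ‖_β` of `φ ∈ 𝓛^β(X₁, …, Xₙ)`. -/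
noncomputable def betaNorm (β : ReasonableCrossnorm 𝕜 X)
    (φ : ContinuousMultilinearMap 𝕜 X 𝕜) : ℝ :=
  opNormWrt β.toSeminorm (normSeminorm 𝕜 𝕜) (linearization φ)

/-- A `Σ`-`β`-`θ`-operator: a multilinear map `R : Z₁ × ⋯ × Z_m → X₁ ⊗ ⋯ ⊗ Xₙ` whose
linearization `(Z₁ ⊗ ⋯ ⊗ Z_m, θ) → (X₁ ⊗ ⋯ ⊗ Xₙ, β)` is bounded and maps decomposable
tensors to decomposable tensors. -/
structure SigmaOperator (θ : ReasonableCrossnorm 𝕜 Z) (β : ReasonableCrossnorm 𝕜 X) where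
  /-- the multilinear map `R` -/
  toMultilinearMap : MultilinearMap 𝕜 Z (⨂[𝕜] i, X i)
  bounded : IsBoundedWrt θ.toSeminorm β.toSeminorm (PiTensorProduct.lift toMultilinearMap)
  mapsTo_segreCone :
    Set.MapsTo (PiTensorProduct.lift toMultilinearMap) (segreCone 𝕜 Z) (segreCone 𝕜 X)

namespace SigmaOperator

variable {θ : ReasonableCrossnorm 𝕜 Z} {β : ReasonableCrossnorm 𝕜 X}

/-- The norm `‖R̃‖` of the linearization of `R` between `(Z₁ ⊗ ⋯ ⊗ Z_m, θ)` and
`(X₁ ⊗ ⋯ ⊗ Xₙ, β)`. -/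
noncomputable def norm (R : SigmaOperator θ β) : ℝ :=
  opNormWrt θ.toSeminorm β.toSeminorm (PiTensorProduct.lift R.toMultilinearMap)

theorem exists_bound (R : SigmaOperator θ β) (T : ContinuousMultilinearMap 𝕜 X Y)
    (S : Y →L[𝕜] W) :
    ∃ C : ℝ, ∀ z, ‖S (linearization T (R.toMultilinearMap z))‖ ≤ C * ∏ i, ‖z i‖ := by
  obtain ⟨C, hC, hR⟩ := R.bounded
  refine ⟨‖S‖ * (‖T‖ * C), fun z => ?_⟩
  have hz : R.toMultilinearMap z ∈ segreCone 𝕜 X := by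
    have := R.mapsTo_segreCone (x := PiTensorProduct.tprod 𝕜 z) ⟨z, rfl⟩
    rwa [PiTensorProduct.lift.tprod] at this
  obtain ⟨x, hx⟩ := hz
  have hx' : PiTensorProduct.tprod 𝕜 x = R.toMultilinearMap z := hx
  have h1 : ∏ i, ‖x i‖ ≤ C * ∏ i, ‖z i‖ := by
    refine (prod_norm_le_injectiveNorm (𝕜 := 𝕜) x).trans ((β.injective_le _).trans ?_)
    have h := hR (PiTensorProduct.tprod 𝕜 z)
    rw [PiTensorProduct.lift.tprod] at h
    rw [hx']
    exact h.trans (mul_le_mul_of_nonneg_left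
      ((θ.le_projective _).trans (PiTensorProduct.projectiveSeminorm_tprod_le z)) hC)
  rw [← hx', linearization_tprod, mul_assoc, mul_assoc]
  refine (S.le_opNorm _).trans (mul_le_mul_of_nonneg_left ?_ (norm_nonneg _))
  exact (T.le_opNorm x).trans (mul_le_mul_of_nonneg_left h1 (norm_nonneg _))

/-- The multilinear operator `S f_T R : Z₁ × ⋯ × Z_m → W`, as a bounded multilinear operator. -/
noncomputable def sandwich (R : SigmaOperator θ β) (T : ContinuousMultilinearMap 𝕜 X Y)
    (S : Y →L[𝕜] W) : ContinuousMultilinearMap 𝕜 Z W where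
  toMultilinearMap :=
    ((S : Y →ₗ[𝕜] W).comp (linearization T)).compMultilinearMap R.toMultilinearMap
  cont := MultilinearMap.continuous_of_bound
    (((S : Y →ₗ[𝕜] W).comp (linearization T)).compMultilinearMap R.toMultilinearMap)
    (R.exists_bound T S).choose (R.exists_bound T S).choose_spec

end SigmaOperator

/-- The multilinear operator `Q_L T (I_{E₁} × ⋯ × I_{Eₙ}) : E₁ × ⋯ × Eₙ → Y/L`. -/
noncomputable def compress (T : ContinuousMultilinearMap 𝕜 X Y)
    (E : ∀ i, Submodule 𝕜 (X i)) (L : Submodule 𝕜 Y) :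
    ContinuousMultilinearMap 𝕜 (fun i => E i) (Y ⧸ L) :=
  L.mkQL.compContinuousMultilinearMap
    (T.compContinuousLinearMap fun i => (E i).subtypeL)

end Operators

/-! ## `Σ`-ideals -/

/-- A `Σ`-ideal `[𝒜, A]` of multilinear operators on the class of Banach spaces over `𝕜`: to every
positive integer `n`, Banach spaces `X₁, …, Xₙ, Y` and reasonable crossnorm `β` on
`X₁ ⊗ ⋯ ⊗ Xₙ` it assigns a linear subspace of the bounded multilinear operators with a
complete norm, subject to the three properties at the end. -/
structure SigmaIdeal (𝕜 : Type) [RCLike 𝕜] where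
  /-- the component `𝒜^β(X₁, …, Xₙ; Y)` -/
  comp : ∀ {n : ℕ} [NeZero n] {X : Fin n → Type u} [∀ i, NormedAddCommGroup (X i)]
    [∀ i, NormedSpace 𝕜 (X i)] [∀ i, CompleteSpace (X i)] (_β : ReasonableCrossnorm 𝕜 X)
    (Y : Type u) [NormedAddCommGroup Y] [NormedSpace 𝕜 Y] [CompleteSpace Y],
    Submodule 𝕜 (ContinuousMultilinearMap 𝕜 X Y)
  /-- the norm `A^β` on the component -/
  norm : ∀ {n : ℕ} [NeZero n] {X : Fin n → Type u} [∀ i, NormedAddCommGroup (X i)]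
    [∀ i, NormedSpace 𝕜 (X i)] [∀ i, CompleteSpace (X i)] (β : ReasonableCrossnorm 𝕜 X)
    (Y : Type u) [NormedAddCommGroup Y] [NormedSpace 𝕜 Y] [CompleteSpace Y],
    Seminorm 𝕜 (comp β Y)
  eq_zero_of_norm_eq_zero : ∀ {n : ℕ} [NeZero n] {X : Fin n → Type u}
    [∀ i, NormedAddCommGroup (X i)] [∀ i, NormedSpace 𝕜 (X i)] [∀ i, CompleteSpace (X i)]
    (β : ReasonableCrossnorm 𝕜 X)
    (Y : Type u) [NormedAddCommGroup Y] [NormedSpace 𝕜 Y] [CompleteSpace Y]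
    (T : comp β Y), norm β Y T = 0 → T = 0
  /-- every `A^β`-Cauchy sequence of the component is `A^β`-convergent in it -/
  complete : ∀ {n : ℕ} [NeZero n] {X : Fin n → Type u}
    [∀ i, NormedAddCommGroup (X i)] [∀ i, NormedSpace 𝕜 (X i)] [∀ i, CompleteSpace (X i)]
    (β : ReasonableCrossnorm 𝕜 X)
    (Y : Type u) [NormedAddCommGroup Y] [NormedSpace 𝕜 Y] [CompleteSpace Y]
    (T : ℕ → comp β Y),
    (∀ ε : ℝ, 0 < ε → ∃ N, ∀ k l, N ≤ k → N ≤ l → norm β Y (T k - T l) < ε) →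
    ∃ T₀ : comp β Y, ∀ ε : ℝ, 0 < ε → ∃ N, ∀ k, N ≤ k → norm β Y (T k - T₀) < ε
  /-- Every `φ · y` with `φ ∈ 𝓛^β(X₁, …, Xₙ)` and `y ∈ Y` is in the component, and
  `A^β(φ · y) ≤ ‖φ‖_β ‖y‖` -/
  rankOne : ∀ {n : ℕ} [NeZero n] {X : Fin n → Type u}
    [∀ i, NormedAddCommGroup (X i)] [∀ i, NormedSpace 𝕜 (X i)] [∀ i, CompleteSpace (X i)]
    (β : ReasonableCrossnorm 𝕜 X)
    (Y : Type u) [NormedAddCommGroup Y] [NormedSpace 𝕜 Y] [CompleteSpace Y]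
    (φ : ContinuousMultilinearMap 𝕜 X 𝕜) (y : Y), IsBetaBounded β φ →
    ∃ h : φ.smulRight y ∈ comp β Y, norm β Y ⟨φ.smulRight y, h⟩ ≤ betaNorm β φ * ‖y‖
  /-- `Lip^β(f_T) ≤ A^β(T)` -/
  lipschitz : ∀ {n : ℕ} [NeZero n] {X : Fin n → Type u}
    [∀ i, NormedAddCommGroup (X i)] [∀ i, NormedSpace 𝕜 (X i)] [∀ i, CompleteSpace (X i)]
    (β : ReasonableCrossnorm 𝕜 X)
    (Y : Type u) [NormedAddCommGroup Y] [NormedSpace 𝕜 Y] [CompleteSpace Y]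
    (T : comp β Y) (p q : segreCone 𝕜 X),
    ‖sigmaOp T.1 p - sigmaOp T.1 q‖ ≤ norm β Y T * β (p.1 - q.1)
  /-- Ideal property: `S f_T R` is in the component `𝒜^θ(Z₁, …, Z_m; W)`, and
  `A^θ(S f_T R) ≤ ‖R̃‖ A^β(T) ‖S‖` -/
  ideal : ∀ {n : ℕ} [NeZero n] {X : Fin n → Type u}
    [∀ i, NormedAddCommGroup (X i)] [∀ i, NormedSpace 𝕜 (X i)] [∀ i, CompleteSpace (X i)]
    (β : ReasonableCrossnorm 𝕜 X)
    (Y : Type u) [NormedAddCommGroup Y] [NormedSpace 𝕜 Y] [CompleteSpace Y]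
    {m : ℕ} [NeZero m] {Z : Fin m → Type u}
    [∀ i, NormedAddCommGroup (Z i)] [∀ i, NormedSpace 𝕜 (Z i)] [∀ i, CompleteSpace (Z i)]
    (θ : ReasonableCrossnorm 𝕜 Z)
    (W : Type u) [NormedAddCommGroup W] [NormedSpace 𝕜 W] [CompleteSpace W]
    (R : SigmaOperator θ β) (T : comp β Y) (S : Y →L[𝕜] W),
    ∃ h : R.sandwich T.1 S ∈ comp θ W,
      norm θ W ⟨R.sandwich T.1 S, h⟩ ≤ R.norm * norm β Y T * ‖S‖

namespace SigmaIdeal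

variable {𝕜 : Type} [RCLike 𝕜] (𝒜 : SigmaIdeal.{u} 𝕜) {n : ℕ} [NeZero n]
  {X : Fin n → Type u} [∀ i, NormedAddCommGroup (X i)] [∀ i, NormedSpace 𝕜 (X i)]
  {Y : Type u} [NormedAddCommGroup Y] [NormedSpace 𝕜 Y] [CompleteSpace Y]

open Classical in
/-- The ideal norm extended to all bounded multilinear operators by `A^β(T) = ∞` for `T` outside
the component. -/
noncomputable def extNorm [∀ i, CompleteSpace (X i)] (β : ReasonableCrossnorm 𝕜 X)
    (T : ContinuousMultilinearMap 𝕜 X Y) : ℝ≥0∞ :=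
  if h : T ∈ 𝒜.comp β Y then ENNReal.ofReal (𝒜.norm β Y ⟨T, h⟩) else ∞

/-- `A^{β|}(Q_L f_T I_{E₁ … Eₙ} : E₁ × ⋯ × Eₙ → Y/L)` for finite dimensional `Eᵢ` and closed `L`. -/
noncomputable def compressNorm (β : ReasonableCrossnorm 𝕜 X)
    (T : ContinuousMultilinearMap 𝕜 X Y) (E : ∀ i, Submodule 𝕜 (X i))
    (hE : ∀ i, FiniteDimensional 𝕜 (E i)) (L : Submodule 𝕜 Y) (hL : IsClosed (L : Set Y)) :
    ℝ≥0∞ :=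
  haveI : ∀ i, CompleteSpace (E i) := fun i => haveI := hE i; FiniteDimensional.complete 𝕜 (E i)
  haveI := hL
  𝒜.extNorm (β.restrict E) (compress T E L)

/-- The norm of the maximal hull: `A^{max,β}(T) = sup A^{β|}(Q_L f_T I_{E₁ … Eₙ})`, the supremum
over all finite dimensional subspaces `Eᵢ` of `Xᵢ` and all closed finite codimensional subspaces
`L` of `Y`. -/
noncomputable def maxNorm (β : ReasonableCrossnorm 𝕜 X)
    (T : ContinuousMultilinearMap 𝕜 X Y) : ℝ≥0∞ :=
  ⨆ (E : ∀ i, Submodule 𝕜 (X i)) (hE : ∀ i, FiniteDimensional 𝕜 (E i))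
    (L : Submodule 𝕜 Y) (hL : IsClosed (L : Set Y)) (_ : FiniteDimensional 𝕜 (Y ⧸ L)),
    𝒜.compressNorm β T E hE L hL

/-- `[𝒜, A]` is maximal if it coincides with its maximal hull: a bounded multilinear operator `T`
is in the component if and only if `A^{max,β}(T) < ∞`, and then `A^β(T) = A^{max,β}(T)`. -/
def IsMaximal : Prop :=
  ∀ (n : ℕ) [NeZero n] (X : Fin n → Type u)
    [∀ i, NormedAddCommGroup (X i)] [∀ i, NormedSpace 𝕜 (X i)] [∀ i, CompleteSpace (X i)]
    (β : ReasonableCrossnorm 𝕜 X)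
    (Y : Type u) [NormedAddCommGroup Y] [NormedSpace 𝕜 Y] [CompleteSpace Y]
    (T : ContinuousMultilinearMap 𝕜 X Y),
    (T ∈ 𝒜.comp β Y ↔ 𝒜.maxNorm β T < ∞) ∧
      ∀ h : T ∈ 𝒜.comp β Y, ENNReal.ofReal (𝒜.norm β Y ⟨T, h⟩) = 𝒜.maxNorm β T

end SigmaIdeal

end SigmaIdeals

/-! One direction is the ideal property alone: `K_Y` is a contraction, so composing with it keeps
`T` in the component and does not increase the norm. For the converse, maximality reduces everything
to the compressions `Q_L T|_E`. Since `Y/L` is finite dimensional, it is isometric to its bidual,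
and `S = K_{Y/L}⁻¹ Q_L**` satisfies `S K_Y = Q_L` and `‖S‖ ≤ ‖Q_L‖ ≤ 1`
(`exists_extension_doubleDual`). Thus `Q_L T|_E = S (K_Y T)|_E`, and the ideal property bounds its
norm by `A(K_Y T)`, uniformly in `E` and `L`. Taking the supremum gives `A^max(T) ≤ A(K_Y T)`
(`maxNorm_le_of_doubleDual_mem`). Maximality is needed only for `T`, never for `K_Y T`. -/

namespace SigmaIdeals

/-! ### Finite dimensional biduals and extension of operators to the bidual -/

section DoubleDual

set_option maxSynthPendingDepth 3

variable {𝕜 : Type} [RCLike 𝕜]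

/-- Every linear functional on `F` is continuous, so `φ` also acts on the algebraic dual, where
finite dimensional reflexivity is `Module.evalEquiv`. -/
theorem inclusionInDoubleDual_surjective (F : Type*) [NormedAddCommGroup F] [NormedSpace 𝕜 F]
    [FiniteDimensional 𝕜 F] :
    Function.Surjective (NormedSpace.inclusionInDoubleDual 𝕜 F) := by
  intro φ
  obtain ⟨y, hy⟩ := (Module.evalEquiv 𝕜 F).surjective
    ((φ : StrongDual 𝕜 F →ₗ[𝕜] 𝕜).comp
      (LinearMap.toContinuousLinearMap (𝕜 := 𝕜) (E := F) (F' := 𝕜)).toLinearMap)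
  refine ⟨y, ContinuousLinearMap.ext fun f => ?_⟩
  have h := LinearMap.congr_fun hy (f : F →ₗ[𝕜] 𝕜)
  have hf : LinearMap.toContinuousLinearMap (f : F →ₗ[𝕜] 𝕜) = f := by ext; rfl
  simpa [hf] using h

/-- A bounded linear operator into a finite dimensional space extends to the bidual with the
same norm bound. -/
theorem exists_extension_doubleDual {Y F : Type*} [NormedAddCommGroup Y] [NormedSpace 𝕜 Y]
    [NormedAddCommGroup F] [NormedSpace 𝕜 F] [FiniteDimensional 𝕜 F] (Q : Y →L[𝕜] F) :
    ∃ S : StrongDual 𝕜 (StrongDual 𝕜 Y) →L[𝕜] F,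
      (∀ y, S (NormedSpace.inclusionInDoubleDual 𝕜 Y y) = Q y) ∧ ‖S‖ ≤ ‖Q‖ := by
  let K : F ≃ₗᵢ[𝕜] StrongDual 𝕜 (StrongDual 𝕜 F) :=
    LinearIsometryEquiv.ofSurjective (NormedSpace.inclusionInDoubleDualLi 𝕜)
      (inclusionInDoubleDual_surjective F)
  have hK : ∀ (y : F) (f : StrongDual 𝕜 F), K y f = f y := fun _ _ => rfl
  -- The functional `φ.comp (precomp 𝕜 Q)` is `Q** φ`. As `K` is isometric, the bound reduces to
  -- `‖Q** φ‖ ≤ ‖φ‖ ‖Q‖`.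
  have hb : ∀ φ : StrongDual 𝕜 (StrongDual 𝕜 Y),
      ‖K.symm (φ.comp (ContinuousLinearMap.precomp 𝕜 Q))‖ ≤ ‖Q‖ * ‖φ‖ := fun φ => by
    rw [K.symm.norm_map, mul_comm]
    refine ContinuousLinearMap.opNorm_le_bound _ (by positivity) fun f => ?_
    refine (φ.le_opNorm _).trans ?_
    rw [mul_assoc]
    refine mul_le_mul_of_nonneg_left ?_ (norm_nonneg _)
    rw [mul_comm]
    exact f.opNorm_comp_le Q
  refine ⟨LinearMap.mkContinuous
    { toFun := fun φ => K.symm (φ.comp (ContinuousLinearMap.precomp 𝕜 Q))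
      map_add' := fun φ ψ => by rw [ContinuousLinearMap.add_comp, map_add]
      map_smul' := fun c φ => by rw [ContinuousLinearMap.smul_comp, map_smul, RingHom.id_apply] }
    ‖Q‖ hb, fun y => ?_, LinearMap.mkContinuous_norm_le _ (norm_nonneg _) _⟩
  -- Naturality of the embedding, `Q** (K_Y y) = K (Q y)`: both sides send `f` to `f (Q y)`.
  refine K.symm_apply_eq.2 (ContinuousLinearMap.ext fun f => ?_)
  rw [hK]
  rfl

end DoubleDual

/-! ### Identity and inclusion as `Σ`-operators -/

section Operators

variable {𝕜 : Type} [RCLike 𝕜] {n : ℕ}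
  {X : Fin n → Type u} [∀ i, NormedAddCommGroup (X i)] [∀ i, NormedSpace 𝕜 (X i)]
  {Y : Type u} [NormedAddCommGroup Y] [NormedSpace 𝕜 Y]
  {W : Type u} [NormedAddCommGroup W] [NormedSpace 𝕜 W]

theorem opNormWrt_le_one {V V' : Type*} [AddCommGroup V] [Module 𝕜 V]
    [AddCommGroup V'] [Module 𝕜 V'] {p : Seminorm 𝕜 V} {q : Seminorm 𝕜 V'} {f : V →ₗ[𝕜] V'}
    (h : ∀ v, q (f v) ≤ p v) : opNormWrt p q f ≤ 1 :=
  csInf_le ⟨0, fun _ hC => hC.1⟩ ⟨zero_le_one, fun v => by rw [one_mul]; exact h v⟩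

/-- The `Σ`-operator `(x¹, …, xⁿ) ↦ x¹ ⊗ ⋯ ⊗ xⁿ`, whose linearization is the identity. -/
noncomputable def SigmaOperator.id (β : ReasonableCrossnorm 𝕜 X) : SigmaOperator β β where
  toMultilinearMap := PiTensorProduct.tprod 𝕜
  bounded := ⟨1, zero_le_one, fun v => by simp⟩
  mapsTo_segreCone := fun v hv => by simpa using hv

theorem SigmaOperator.norm_id_le (β : ReasonableCrossnorm 𝕜 X) : (id β).norm ≤ 1 :=
  opNormWrt_le_one fun v => by simp [id]

theorem SigmaOperator.id_sandwich (β : ReasonableCrossnorm 𝕜 X)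
    (T : ContinuousMultilinearMap 𝕜 X Y) (S : Y →L[𝕜] W) :
    (id β).sandwich T S = S.compContinuousMultilinearMap T := by
  ext x
  change S (linearization T (PiTensorProduct.tprod 𝕜 x)) = S (T x)
  rw [linearization_tprod]

/-- The `Σ`-operator of the inclusions `Eᵢ → Xᵢ`, whose linearization is
`E₁ ⊗ ⋯ ⊗ Eₙ → X₁ ⊗ ⋯ ⊗ Xₙ`. -/
noncomputable def SigmaOperator.incl (β : ReasonableCrossnorm 𝕜 X)
    (E : ∀ i, Submodule 𝕜 (X i)) : SigmaOperator (β.restrict E) β where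
  toMultilinearMap := (PiTensorProduct.tprod 𝕜).compLinearMap fun i => (E i).subtype
  bounded := ⟨1, zero_le_one, fun v => by rw [one_mul]; exact le_rfl⟩
  mapsTo_segreCone := by
    rintro _ ⟨x, rfl⟩
    exact ⟨fun i => x i, by simp⟩

/-- The restricted crossnorm is by definition `β` pulled back along `tensorIncl E`, so the
linearization is isometric. -/
theorem SigmaOperator.norm_incl_le (β : ReasonableCrossnorm 𝕜 X)
    (E : ∀ i, Submodule 𝕜 (X i)) : (incl β E).norm ≤ 1 :=
  opNormWrt_le_one fun _ => le_rfl

theorem SigmaOperator.incl_sandwich (β : ReasonableCrossnorm 𝕜 X)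
    (E : ∀ i, Submodule 𝕜 (X i)) (T : ContinuousMultilinearMap 𝕜 X Y) (S : Y →L[𝕜] W) :
    (incl β E).sandwich T S = S.compContinuousMultilinearMap
      (T.compContinuousLinearMap fun i => (E i).subtypeL) := by
  ext x
  change S (linearization T (PiTensorProduct.tprod 𝕜 fun i => (x i : X i))) = S (T fun i => x i)
  rw [linearization_tprod]

end Operators

/-! ### Consequences of the ideal property and the bound on the maximal norm -/

namespace SigmaIdeal

variable {𝕜 : Type} [RCLike 𝕜] (𝒜 : SigmaIdeal.{u} 𝕜) {n : ℕ} [NeZero n]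
  {X : Fin n → Type u} [∀ i, NormedAddCommGroup (X i)] [∀ i, NormedSpace 𝕜 (X i)]
  [∀ i, CompleteSpace (X i)]
  {Y : Type u} [NormedAddCommGroup Y] [NormedSpace 𝕜 Y] [CompleteSpace Y]
  {W : Type u} [NormedAddCommGroup W] [NormedSpace 𝕜 W] [CompleteSpace W]

theorem sandwich_mem_of_le_one {m : ℕ} [NeZero m] {Z : Fin m → Type u}
    [∀ i, NormedAddCommGroup (Z i)] [∀ i, NormedSpace 𝕜 (Z i)] [∀ i, CompleteSpace (Z i)]
    {θ : ReasonableCrossnorm 𝕜 Z} {β : ReasonableCrossnorm 𝕜 X} {R : SigmaOperator θ β}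
    (hR : R.norm ≤ 1) (T : 𝒜.comp β Y) {S : Y →L[𝕜] W} (hS : ‖S‖ ≤ 1) :
    ∃ h : R.sandwich T.1 S ∈ 𝒜.comp θ W,
      𝒜.norm θ W ⟨R.sandwich T.1 S, h⟩ ≤ 𝒜.norm β Y T := by
  obtain ⟨h, hle⟩ := 𝒜.ideal β Y θ W R T S
  have hT : 0 ≤ 𝒜.norm β Y T := apply_nonneg _ _
  have h1 : R.norm * 𝒜.norm β Y T ≤ 𝒜.norm β Y T := mul_le_of_le_one_left hT hR
  exact ⟨h, hle.trans ((mul_le_mul_of_nonneg_right h1 (norm_nonneg S)).trans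
    (mul_le_of_le_one_right hT hS))⟩

/-- The ideal property with the identity `Σ`-operator on the right. -/
theorem comp_mem_of_norm_le_one {β : ReasonableCrossnorm 𝕜 X} (T : 𝒜.comp β Y)
    {S : Y →L[𝕜] W} (hS : ‖S‖ ≤ 1) :
    ∃ h : S.compContinuousMultilinearMap T.1 ∈ 𝒜.comp β W,
      𝒜.norm β W ⟨S.compContinuousMultilinearMap T.1, h⟩ ≤ 𝒜.norm β Y T := by
  have h := 𝒜.sandwich_mem_of_le_one (SigmaOperator.norm_id_le β) T hS
  rwa [SigmaOperator.id_sandwich] at h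

theorem extNorm_of_mem {β : ReasonableCrossnorm 𝕜 X} {T : ContinuousMultilinearMap 𝕜 X Y}
    (h : T ∈ 𝒜.comp β Y) : 𝒜.extNorm β T = ENNReal.ofReal (𝒜.norm β Y ⟨T, h⟩) :=
  dif_pos h

theorem doubleDual_mem {β : ReasonableCrossnorm 𝕜 X} (T : 𝒜.comp β Y) :
    ∃ h : (NormedSpace.inclusionInDoubleDual 𝕜 Y).compContinuousMultilinearMap T.1 ∈
        𝒜.comp β (StrongDual 𝕜 (StrongDual 𝕜 Y)),
      𝒜.norm β (StrongDual 𝕜 (StrongDual 𝕜 Y)) ⟨_, h⟩ ≤ 𝒜.norm β Y T :=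
  𝒜.comp_mem_of_norm_le_one (W := StrongDual 𝕜 (StrongDual 𝕜 Y)) T
    (NormedSpace.inclusionInDoubleDual_norm_le 𝕜 Y)

theorem maxNorm_le_of_doubleDual_mem {β : ReasonableCrossnorm 𝕜 X}
    {T : ContinuousMultilinearMap 𝕜 X Y}
    (hKT : (NormedSpace.inclusionInDoubleDual 𝕜 Y).compContinuousMultilinearMap T ∈
      𝒜.comp β (StrongDual 𝕜 (StrongDual 𝕜 Y))) :
    𝒜.maxNorm β T ≤ ENNReal.ofReal (𝒜.norm β (StrongDual 𝕜 (StrongDual 𝕜 Y)) ⟨_, hKT⟩) := by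
  refine iSup_le fun E => iSup_le fun hE => iSup_le fun L => iSup_le fun hL => iSup_le fun hQ => ?_
  have : ∀ i, CompleteSpace (E i) := fun i => haveI := hE i; FiniteDimensional.complete 𝕜 (E i)
  -- Finite codimension of `L` enters here: `Q_L` factors through `K_Y` without loss of norm.
  obtain ⟨S, hS, hSn⟩ := exists_extension_doubleDual L.mkQL
  have hQn : ‖L.mkQL‖ ≤ 1 := ContinuousLinearMap.opNorm_le_bound _ zero_le_one fun y => by
    rw [one_mul]
    exact Submodule.Quotient.norm_mk_le L y
  obtain ⟨h, hle⟩ := 𝒜.sandwich_mem_of_le_one (SigmaOperator.norm_incl_le β E) ⟨_, hKT⟩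
    (hSn.trans hQn)
  -- On `E` the compression of `T` is also a sandwich of `K_Y T`, so it lies in the component and
  -- its extended norm is finite.
  have hc : (SigmaOperator.incl β E).sandwich (Y := StrongDual 𝕜 (StrongDual 𝕜 Y))
      ((NormedSpace.inclusionInDoubleDual 𝕜 Y).compContinuousMultilinearMap T) S =
        compress T E L := by
    rw [SigmaOperator.incl_sandwich]
    ext x
    exact hS _
  rw [compressNorm, ← hc, 𝒜.extNorm_of_mem h]
  exact ENNReal.ofReal_le_ofReal hle

end SigmaIdeal

end SigmaIdeals

theorem mainTheorem6 {𝕜 : Type} [RCLike 𝕜] (𝒜 : SigmaIdeals.SigmaIdeal.{u} 𝕜)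
    (h𝒜 : 𝒜.IsMaximal) (n : ℕ) [NeZero n] (X : Fin n → Type u)
    [∀ i, NormedAddCommGroup (X i)] [∀ i, NormedSpace 𝕜 (X i)] [∀ i, CompleteSpace (X i)]
    (Y : Type u) [NormedAddCommGroup Y] [NormedSpace 𝕜 Y] [CompleteSpace Y]
    (β : SigmaIdeals.ReasonableCrossnorm 𝕜 X) (T : ContinuousMultilinearMap 𝕜 X Y) :
    (T ∈ 𝒜.comp β Y ↔
      (NormedSpace.inclusionInDoubleDual 𝕜 Y).compContinuousMultilinearMap T ∈
        𝒜.comp β (StrongDual 𝕜 (StrongDual 𝕜 Y))) ∧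
    ∀ (hT : T ∈ 𝒜.comp β Y)
      (hKT : (NormedSpace.inclusionInDoubleDual 𝕜 Y).compContinuousMultilinearMap T ∈
        𝒜.comp β (StrongDual 𝕜 (StrongDual 𝕜 Y))),
      𝒜.norm β Y ⟨T, hT⟩ =
        𝒜.norm β (StrongDual 𝕜 (StrongDual 𝕜 Y))
          ⟨(NormedSpace.inclusionInDoubleDual 𝕜 Y).compContinuousMultilinearMap T, hKT⟩ := by
  refine ⟨⟨fun hT => (𝒜.doubleDual_mem ⟨T, hT⟩).1, fun hKT => (h𝒜 n X β Y T).1.2 ?_⟩,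
    fun hT hKT => ?_⟩
  · exact (𝒜.maxNorm_le_of_doubleDual_mem hKT).trans_lt ENNReal.ofReal_lt_top
  · refine le_antisymm ?_ (𝒜.doubleDual_mem ⟨T, hT⟩).2
    have h := 𝒜.maxNorm_le_of_doubleDual_mem hKT
    -- Maximality turns the bound on `A^max(T)` into one on `A(T)`; `ENNReal.ofReal` then cancels
    -- because `A(K_Y T)` is nonnegative.
    rw [← (h𝒜 n X β Y T).2 hT] at h
    exact (ENNReal.ofReal_le_ofReal_iff (apply_nonneg _ _)).1 h
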